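/- An \emph{$i$-tree} is a directed tree with $i$ vertices, named $1,\dots,i$, whose edges are named $1',\dots,(i-1)'$; write $j'=(p,q)$ if edge $j'$ points from $p$ to $q$. A \emph{tree sequence} of order $n$ is $\mathcal T=(T_1,\dots,T_n)$ with $T_i$ an $i$-tree. For an $i$-tree $T$ and $\mathbf k\in\mathbb Z^i$, an edge $j'=(p,q)$ is an \emph{inversion} of $(T,\mathbf k)$ if $k_p+p\ge k_q+q$; a vector $\mathbf l\in\mathbb Z^{i-1}$ is \emph{admissible} for $(T,\mathbf k)$ if for every edge $j'=(p,q)$ of $T$ $$\min(k_p+p,k_q+q)\le l_j+j<\max(k_p+p,k_q+q).$$ The \emph{sign} of an $i$-tree $T$ is defined as follows. Fix a root $r$ and orient all edges away from $r$ (the standard orientation). Let $\pi$ be the permutation of $\{1,\dots,i\}$ that lists $r$, followed by the heads of $1',2',\dots,(i-1)'$ in the standard orientation. Then $\operatorname{sgn}T=(-1)^{a}\operatorname{sgn}\pi$, where $a$ is the number of edges of $T$ whose orientation in $T$ differs from the standard one; this does not depend on $r$. Put $\operatorname{sgn}\mathcal T=\prod_{i=1}^n\operatorname{sgn}T_i$.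 \textbf{Theorem.} Let $\mathcal T=(T_1,\dots,T_n)$ be a tree sequence of order $n$ and $\mathbf k\in\mathbb Z^n$. Let $\mathcal L_n(\mathcal T,\mathbf k)$ be the set of Gelfand--Tsetlin tree sequences, that is, of sequences $\mathbf L=(\mathbf l_1,\dots,\mathbf l_n)$ with $\mathbf l_i\in\mathbb Z^i$, $\mathbf l_n=\mathbf k$ and $\mathbf l_{i-1}$ admissible for $(T_i,\mathbf l_i)$ for $2\le i\le n$, and let $\operatorname{sgn}\mathbf L=(-1)^{b}\operatorname{sgn}\mathcal T$, where $b$ is the total number of inversions of the pairs $(T_i,\mathbf l_i)$, $2\le i\le n$. Then $\mathcal L_n(\mathcal T,\mathbf k)$ is finite and, whichever roots are used to compute the signs of the trees, $$L_n(\mathcal T,\mathbf k):=\sum_{\mathbf L\in\mathcal L_n(\mathcal T,\mathbf k)}\operatorname{sgn}\mathbf L=\prod_{1\le i<j\le n}\frac{k_j-k_i+j-i}{j-i}.$$ In particular, let every $T_i$ be the path with edges $j'=(j,j+1)$, $1\le j<i$. Then the elements of $\mathcal L_n(\mathcal T,\mathbf k)$ are exactly the (generalized) Gelfand--Tsetlin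 patterns with bottom row $\mathbf k$, that is, the integer arrays $(a_{i,j})_{1\le j\le i\le n}$ with $(a_{n,1},\dots,a_{n,n})=\mathbf k$ such that for all $1\le j\le i\le n-1$ we have $a_{i+1,j}\le a_{i,j}\le a_{i+1,j+1}$ if $a_{i+1,j}\le a_{i+1,j+1}$, and $a_{i+1,j}>a_{i,j}>a_{i+1,j+1}$ otherwise; in the latter case $a_{i,j}$ is called an inversion. The sign of such an element equals $(-1)^{\#\text{inversions of the pattern}}$, so the signed count of these patterns is given by the same product. -/

import Mathlib

/-- A directed tree with `m + 1` vertices whose vertices are identified with `1, …, m + 1` and whose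
`m` edges are identified with `1', …, m'`. The vertex named `v + 1` is `v : Fin (m + 1)`, the edge
named `(e + 1)'` is `e : Fin m`, and this edge is the ordered pair `(tail e, head e)`.
(A tree on `m + 1` vertices has `m` edges, so the condition forces the `m` edges to be pairwise
distinct as undirected edges, and none of them is a loop.) -/
structure NamedTree (m : ℕ) where
  tail : Fin m → Fin (m + 1)
  head : Fin m → Fin (m + 1)
  isTree : (SimpleGraph.fromEdgeSet (Set.range fun e => s(tail e, head e))).IsTree

namespace NamedTree

variable {m : ℕ}

/-- The underlying undirected tree. -/
def graph (T : NamedTree m) : SimpleGraph (Fin (m + 1)) :=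
  SimpleGraph.fromEdgeSet (Set.range fun e => s(T.tail e, T.head e))

/-- The set of reversed edges with respect to the root `r`: those edges that are not oriented away
from the root, i.e. whose head is closer to the root than their tail. -/
noncomputable def reversed (T : NamedTree m) (r : Fin (m + 1)) : Finset (Fin m) :=
  Finset.univ.filter fun e => T.graph.dist r (T.head e) < T.graph.dist r (T.tail e)

/-- The head of the edge `e` in the standard orientation with respect to the root `r`. -/
noncomputable def standardHead (T : NamedTree m) (r : Fin (m + 1)) (e : Fin m) : Fin (m + 1) :=
  if e ∈ T.reversed r then T.tail e else T.head e

theorem rootWord_bijective (T : NamedTree m) (r : Fin (m + 1)) :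
    Function.Bijective (Fin.cons r (T.standardHead r) : Fin (m + 1) → Fin (m + 1)) := by
  rw [← Finite.surjective_iff_bijective]
  intro v
  by_cases hv : v = r
  · exact ⟨0, by simp [hv]⟩
  have hc : T.graph.Connected := T.isTree.1
  obtain ⟨p, hp⟩ := hc.exists_walk_length_eq_dist v r
  cases p with
  | nil => exact absurd rfl hv
  | @cons _ u _ h q =>
    have h1 : T.graph.dist r u < T.graph.dist r v := by
      rw [T.graph.dist_comm (u := r) (v := v), ← hp, T.graph.dist_comm]
      have := T.graph.dist_le q
      simp only [SimpleGraph.Walk.length_cons]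
      omega
    have h2 : s(v, u) ∈ Set.range fun e => s(T.tail e, T.head e) :=
      ((SimpleGraph.fromEdgeSet_adj _).1 h).1
    obtain ⟨e, he⟩ := h2
    refine ⟨e.succ, ?_⟩
    rw [Fin.cons_succ, standardHead]
    rcases Sym2.eq_iff.1 he with ⟨ha, hb⟩ | ⟨ha, hb⟩
    · have : e ∈ T.reversed r := by simp [reversed, ha, hb, h1]
      rw [if_pos this, ha]
    · have : e ∉ T.reversed r := by
        simp only [reversed, Finset.mem_filter, Finset.mem_univ, true_and, ha, hb]
        omega
      rw [if_neg this, hb]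

/-- The permutation `π` that lists the root `r`, followed by the heads of the edges `1', 2', …, m'`
in the standard orientation with respect to `r`. -/
noncomputable def rootPerm (T : NamedTree m) (r : Fin (m + 1)) : Equiv.Perm (Fin (m + 1)) :=
  Equiv.ofBijective _ (T.rootWord_bijective r)

/-- The sign of the tree, computed with the root `r`. -/
noncomputable def sign (T : NamedTree m) (r : Fin (m + 1)) : ℤ :=
  (-1) ^ (T.reversed r).card * (Equiv.Perm.sign (T.rootPerm r) : ℤ)

/-- The inversions of the pair `(T, k)`, where `k` is a shifted vertex labelling: the vertex named
`v + 1` carries the label `k v + (v + 1)`. -/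
def inversions (T : NamedTree m) (k : Fin (m + 1) → ℤ) : Finset (Fin m) :=
  Finset.univ.filter fun e =>
    ¬ (k (T.tail e) + ((T.tail e : ℤ) + 1) < k (T.head e) + ((T.head e : ℤ) + 1))

/-- The shifted edge labelling `l` is admissible for the pair `(T, k)`; the edge named `(e + 1)'`
carries the label `l e + (e + 1)`. -/
def Admissible (T : NamedTree m) (k : Fin (m + 1) → ℤ) (l : Fin m → ℤ) : Prop :=
  ∀ e : Fin m,
    if k (T.tail e) + ((T.tail e : ℤ) + 1) < k (T.head e) + ((T.head e : ℤ) + 1) then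
      k (T.tail e) + ((T.tail e : ℤ) + 1) ≤ l e + ((e : ℤ) + 1) ∧
        l e + ((e : ℤ) + 1) < k (T.head e) + ((T.head e : ℤ) + 1)
    else
      k (T.head e) + ((T.head e : ℤ) + 1) ≤ l e + ((e : ℤ) + 1) ∧
        l e + ((e : ℤ) + 1) < k (T.tail e) + ((T.tail e : ℤ) + 1)

/-- The basic tree on `m + 1` vertices: the path with edges `j' = (j, j + 1)`. -/
def basic (m : ℕ) : NamedTree m where
  tail := Fin.castSucc
  head := Fin.succ
  isTree := by
    have hG : SimpleGraph.fromEdgeSet (Set.range fun e : Fin m => s(e.castSucc, e.succ)) =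
        SimpleGraph.pathGraph (m + 1) := by
      ext u v
      rw [SimpleGraph.fromEdgeSet_adj, SimpleGraph.pathGraph_adj]
      constructor
      · rintro ⟨⟨e, he⟩, -⟩
        rcases Sym2.eq_iff.1 he with ⟨rfl, rfl⟩ | ⟨rfl, rfl⟩ <;> simp
      · rintro (h | h)
        · refine ⟨⟨⟨u, by omega⟩, Sym2.eq_iff.2 (Or.inl ⟨?_, ?_⟩)⟩, ?_⟩
          · ext; simp
          · ext; simp [h]
          · rintro rfl; omega
        · refine ⟨⟨⟨v, by omega⟩, Sym2.eq_iff.2 (Or.inr ⟨?_, ?_⟩)⟩, ?_⟩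
          · ext; simp
          · ext; simp [h]
          · rintro rfl; omega
    have hc : (SimpleGraph.fromEdgeSet
        (Set.range fun e : Fin m => s(e.castSucc, e.succ))).Connected :=
      hG ▸ SimpleGraph.pathGraph_connected m
    refine SimpleGraph.isTree_iff_connected_and_card.2 ⟨hc, le_antisymm ?_ ?_⟩
    · have h1 : Nat.card (SimpleGraph.fromEdgeSet
          (Set.range fun e : Fin m => s(e.castSucc, e.succ))).edgeSet ≤
          Nat.card (Set.range fun e : Fin m => s(e.castSucc, e.succ)) := by
        refine Nat.card_mono (Set.toFinite _) ?_
        rw [SimpleGraph.edgeSet_fromEdgeSet]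
        exact Set.sdiff_subset
      have h2 : Nat.card (Set.range fun e : Fin m => s(e.castSucc, e.succ)) ≤ m := by
        simpa using Finite.card_range_le fun e : Fin m => s(e.castSucc, e.succ)
      rw [Nat.card_fin]
      omega
    · exact hc.card_vert_le_card_edgeSet_add_one

end NamedTree

/-- A tree sequence `(T_1, …, T_n)` of order `n`; the tree `T_{i+1}`, which has `i + 1` vertices, is
the value at `i : Fin n`. -/
abbrev TreeSeq (n : ℕ) : Type := (i : Fin n) → NamedTree i

/-- Sequences `(l_1, …, l_n)` of integer vectors with `l_i ∈ ℤ^i`, equivalently triangular arrays.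
The vector `l_i` is the value at `i`; the value at `0` is the empty vector. -/
abbrev Rows (n : ℕ) : Type := (i : Fin (n + 1)) → (Fin (i : ℕ) → ℤ)

namespace TreeSeq

variable {n : ℕ}

/-- The set of Gelfand–Tsetlin tree sequences associated with the tree sequence `T` and the shifted
labelling `k` of the vertices of its last tree: `l_n = k` and `l_{i-1}` is admissible for the pair
`(T_i, l_i)` for all `i`. (There is no condition at `i = 1`, since `T_1` has no edges.) -/
def gelfandTsetlin (T : TreeSeq n) (k : Fin n → ℤ) : Set (Rows n) :=
  {L | L (Fin.last n) = k ∧ ∀ i : Fin n, (T i).Admissible (L i.succ) (L i.castSucc)}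

/-- The sign of the tree sequence, where the sign of each tree is computed with the root given
by `r`. -/
noncomputable def sign (T : TreeSeq n) (r : (i : Fin n) → Fin ((i : ℕ) + 1)) : ℤ :=
  ∏ i, (T i).sign (r i)

/-- The sign of a Gelfand–Tsetlin tree sequence. -/
noncomputable def signOf (T : TreeSeq n) (r : (i : Fin n) → Fin ((i : ℕ) + 1)) (L : Rows n) : ℤ :=
  (-1) ^ (∑ i : Fin n, ((T i).inversions (L i.succ)).card) * T.sign r

/-- The signed enumeration of the Gelfand–Tsetlin tree sequences. -/
noncomputable def signedEnum (T : TreeSeq n) (r : (i : Fin n) → Fin ((i : ℕ) + 1))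
    (k : Fin n → ℤ) : ℤ :=
  ∑ᶠ L ∈ T.gelfandTsetlin k, T.signOf r L

/-- The sequence of basic trees (paths). -/
def basic (n : ℕ) : TreeSeq n := fun i => NamedTree.basic i

end TreeSeq

/-- The set of generalized Gelfand–Tsetlin patterns with bottom row `k`: triangular arrays with
`a_{i+1,j} ≤ a_{i,j} ≤ a_{i+1,j+1}` if `a_{i+1,j} ≤ a_{i+1,j+1}`, and
`a_{i+1,j} > a_{i,j} > a_{i+1,j+1}` otherwise. -/
def generalizedGTPatterns {n : ℕ} (k : Fin n → ℤ) : Set (Rows n) :=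
  {a | a (Fin.last n) = k ∧ ∀ (i : Fin n) (j : Fin (i : ℕ)),
    if a i.succ j.castSucc ≤ a i.succ j.succ then
      a i.succ j.castSucc ≤ a i.castSucc j ∧ a i.castSucc j ≤ a i.succ j.succ
    else
      a i.succ j.castSucc > a i.castSucc j ∧ a i.castSucc j > a i.succ j.succ}

/-- The sign `(-1)^(number of inversions)` of a generalized Gelfand–Tsetlin pattern; the entry
`a_{i,j}` is an inversion if `a_{i+1,j} > a_{i+1,j+1}`. -/
def gtPatternSign {n : ℕ} (a : Rows n) : ℤ :=
  (-1) ^ (∑ i : Fin n, (Finset.univ.filter fun j : Fin (i : ℕ) =>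
    a i.succ j.castSucc > a i.succ j.succ).card)

/-! For labels `x_i = k_i + i`, the product in the theorem is `det (binom(x_i, j))`, a rescaled
Vandermonde determinant. It suffices that this determinant obeys the recursion obtained by fixing
the penultimate row of a Gelfand–Tsetlin tree sequence.

Multiply the binomial matrix on the left by the signed incidence matrix of the tree, with an extra
row marking the root. That incidence matrix has determinant `sgn T` (`det_rootedIncidence`). The
first column of the product is `(1, 0, …, 0)`, so what remains is the determinant of the differences
`binom(x_head, j+1) - binom(x_tail, j+1)`, one row per edge (`sign_mul_det_binomMatrix`). By
Pascal's rule each row telescopes to a signed sum of rows `binom(y, j)` over the admissible labels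
`y` of its edge, negative exactly at inversions. Multilinearity turns this into the signed sum over
admissible vectors (`sum_admissibleFinset`), and induction on `n` finishes. -/

/-! ### Binomial determinants and the product formula -/

/-- The matrix of binomial coefficients `binom (x i) j`. -/
noncomputable def binomMatrix {n : ℕ} (x : Fin n → ℤ) : Matrix (Fin n) (Fin n) ℤ :=
  Matrix.of fun i j => Ring.choose (x i) (j : ℕ)

/-- The falling factorials `j! * binom(x, j)` are monic of degree `j`, so they may replace the
powers in the Vandermonde determinant. -/
theorem prod_sub_eq_prod_factorial_mul_det_binomMatrix {n : ℕ} (x : Fin n → ℤ) :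
    ∏ i : Fin n, ∏ j ∈ Finset.Ioi i, (x j - x i) =
      (∏ j : Fin n, ((j : ℕ).factorial : ℤ)) * (binomMatrix x).det := by
  rw [← Matrix.det_vandermonde, Matrix.det_eval_matrixOfPolynomials_eq_det_vandermonde x
    (fun i => descPochhammer ℤ i) (fun i => descPochhammer_natDegree ℤ i)
    (fun i => monic_descPochhammer ℤ i), ← Matrix.det_mul_row]
  congr 1
  ext i j
  simp [binomMatrix, Polynomial.eval_eq_smeval, Ring.descPochhammer_eq_factorial_smul_choose]

theorem det_binomMatrix_natCast (n : ℕ) : (binomMatrix fun i : Fin n => ((i : ℕ) : ℤ)).det = 1 := by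
  rw [Matrix.det_of_isLowerTriangular]
  · simp [binomMatrix, Ring.choose_natCast]
  · intro i j hij
    have hij' : i < j := hij
    simpa [binomMatrix, Ring.choose_natCast] using Nat.choose_eq_zero_of_lt hij'

theorem det_binomMatrix_eq_prod_div {n : ℕ} (x : Fin n → ℤ) :
    ((binomMatrix x).det : ℚ) =
      ∏ i : Fin n, ∏ j ∈ Finset.Ioi i, ((x j : ℚ) - x i) / ((j : ℚ) - (i : ℚ)) := by
  have h := prod_sub_eq_prod_factorial_mul_det_binomMatrix x
  -- At `x_i = i` the binomial determinant is `1`, which evaluates the factorials as the product of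
  -- the denominators `j - i`.
  have h' := prod_sub_eq_prod_factorial_mul_det_binomMatrix fun i : Fin n => ((i : ℕ) : ℤ)
  rw [det_binomMatrix_natCast, mul_one] at h'
  rw [← h'] at h
  have hq := congrArg (Int.cast : ℤ → ℚ) h
  simp only [Int.cast_mul, Int.cast_prod, Int.cast_sub, Int.cast_natCast] at hq
  simp only [Finset.prod_div_distrib]
  have hne : ∏ i : Fin n, ∏ j ∈ Finset.Ioi i, ((j : ℚ) - (i : ℚ)) ≠ 0 := by
    refine Finset.prod_ne_zero_iff.2 fun i _ => Finset.prod_ne_zero_iff.2 fun j hij => ?_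
    rw [Finset.mem_Ioi] at hij
    rw [sub_ne_zero]
    exact_mod_cast (Fin.val_ne_of_ne hij.ne')
  rw [hq]
  exact (mul_div_cancel_left₀ _ hne).symm

/-! ### Signed telescoping sums -/

theorem sum_Ico_eq_sub_of_add_one {f g : ℤ → ℤ} (h : ∀ y, f (y + 1) = f y + g y) {a b : ℤ}
    (hab : a ≤ b) : ∑ y ∈ Finset.Ico a b, g y = f b - f a := by
  induction b, hab using Int.leInduction with
  | base => simp
  | succ b hb ih =>
    have : Finset.Ico a (b + 1) = insert b (Finset.Ico a b) := by
      ext y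
      simp only [Finset.mem_Ico, Finset.mem_insert]
      omega
    rw [this, Finset.sum_insert (by simp), ih, h]
    ring

/-- The sum of `g` over the half-open interval with end points `a - c` and `b - c`, counted
negatively if `b ≤ a`. -/
theorem signed_sum_Ico_eq_sub {f g : ℤ → ℤ} (h : ∀ y, f (y + 1) = f y + g y) (a b c : ℤ) :
    ∑ y ∈ Finset.Ico (min a b - c) (max a b - c), (if a < b then 1 else -1) * g (y + c) =
      f b - f a := by
  have h' : ∀ y, f (y + 1 + c) = f (y + c) + g (y + c) := fun y => by
    rw [← h, add_right_comm]
  have key := sum_Ico_eq_sub_of_add_one (f := fun y => f (y + c)) (g := fun y => g (y + c)) h'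
    (sub_le_sub_right (min_le_max (a := a) (b := b)) c)
  rw [← Finset.mul_sum, key]
  by_cases hab : a < b
  · simp [hab, hab.le]
  -- Here the interval runs from `b` to `a`, and the factor `-1` restores the order. If `a = b` it
  -- is empty, so the sign chosen for ties is immaterial.
  · simp [hab, not_lt.1 hab]

/-! ### The sign of a tree as a determinant -/

namespace NamedTree

variable {m : ℕ}

/-- The tail of the edge `e` in the standard orientation with respect to the root `r`. -/
noncomputable def standardTail (T : NamedTree m) (r : Fin (m + 1)) (e : Fin m) : Fin (m + 1) :=
  if e ∈ T.reversed r then T.head e else T.tail e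

/-- A loop contributes no edge to `graph`, so the other `m - 1` names would have to supply all `m`
edges of a tree. -/
theorem tail_ne_head (T : NamedTree m) (e : Fin m) : T.tail e ≠ T.head e := by
  intro hloop
  have hsub : T.graph.edgeSet ⊆ (fun e => s(T.tail e, T.head e)) '' ({e}ᶜ : Set (Fin m)) := by
    rw [graph, SimpleGraph.edgeSet_fromEdgeSet]
    rintro _ ⟨⟨e', rfl⟩, hdiag⟩
    refine ⟨e', ?_, rfl⟩
    rintro rfl
    exact hdiag (by simpa using hloop)
  have h1 : T.graph.edgeSet.ncard ≤ ({e}ᶜ : Set (Fin m)).ncard :=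
    (Set.ncard_le_ncard hsub).trans Set.ncard_image_le
  have h2 := (SimpleGraph.isTree_iff_connected_and_card.1 T.isTree).2
  rw [Set.ncard_compl, Set.ncard_singleton, Nat.card_fin] at h1
  change T.graph.edgeSet.ncard + 1 = _ at h2
  rw [Nat.card_fin] at h2
  have := e.pos
  omega

/-- Adjacent vertices of a tree are never equidistant from the root, so the choice made by
`reversed` is strict. -/
theorem dist_standardTail_lt (T : NamedTree m) (r : Fin (m + 1)) (e : Fin m) :
    T.graph.dist r (T.standardTail r e) < T.graph.dist r (T.standardHead r e) := by
  have hne : T.graph.dist r (T.tail e) ≠ T.graph.dist r (T.head e) := by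
    have hadj : T.graph.Adj (T.tail e) (T.head e) :=
      (SimpleGraph.fromEdgeSet_adj _).2 ⟨⟨e, rfl⟩, T.tail_ne_head e⟩
    exact SimpleGraph.IsTree.dist_ne_of_adj T.isTree r hadj
  unfold standardTail standardHead
  split_ifs with h <;> simp only [reversed, Finset.mem_filter, Finset.mem_univ, true_and] at h <;>
    omega

/-- The signed incidence matrix of the tree, with an additional row that marks the root `r`. -/
def rootedIncidence (T : NamedTree m) (r : Fin (m + 1)) : Matrix (Fin (m + 1)) (Fin (m + 1)) ℤ :=
  Matrix.of (Fin.cons (Pi.single r 1) fun e => Pi.single (T.head e) 1 - Pi.single (T.tail e) 1)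

/-- The rooted incidence matrix of the tree in its standard orientation. -/
noncomputable def standardIncidence (T : NamedTree m) (r : Fin (m + 1)) :
    Matrix (Fin (m + 1)) (Fin (m + 1)) ℤ :=
  Matrix.of (Fin.cons (Pi.single r 1) fun e =>
    Pi.single (T.standardHead r e) 1 - Pi.single (T.standardTail r e) 1)

theorem rootPerm_zero (T : NamedTree m) (r : Fin (m + 1)) : T.rootPerm r 0 = r := rfl

theorem rootPerm_succ (T : NamedTree m) (r : Fin (m + 1)) (e : Fin m) :
    T.rootPerm r e.succ = T.standardHead r e := rfl

/-- Reordering the columns by `π` puts the head of each edge on the diagonal. The only other nonzero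
entry of the row is at the tail, which is strictly closer to the root, so the matrix is triangular
with respect to distance and has unit diagonal. -/
theorem det_standardIncidence_submatrix (T : NamedTree m) (r : Fin (m + 1)) :
    ((T.standardIncidence r).submatrix id (T.rootPerm r)).det = 1 := by
  -- The order dual is needed because entries vanish where the column's vertex is farther from the
  -- root than the row's.
  set b : Fin (m + 1) → ℕᵒᵈ := fun i => OrderDual.toDual (T.graph.dist r (T.rootPerm r i))
  have hentry : ∀ i j, b j ≤ b i →
      (T.standardIncidence r).submatrix id (T.rootPerm r) i j = if i = j then 1 else 0 := by
    intro i j hij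
    have hij' : T.graph.dist r (T.rootPerm r i) ≤ T.graph.dist r (T.rootPerm r j) := hij
    have hinj : i = j ↔ T.rootPerm r i = T.rootPerm r j := (T.rootPerm r).injective.eq_iff.symm
    rw [Matrix.submatrix_apply, id]
    simp only [hinj]
    revert hij'
    refine Fin.cases (fun _ => ?_) (fun e hij' => ?_) i
    · simp [standardIncidence, rootPerm_zero, Pi.single_apply, eq_comm (a := r)]
    · have hne : T.rootPerm r j ≠ T.standardTail r e := by
        intro h
        rw [h, rootPerm_succ] at hij'
        exact absurd (T.dist_standardTail_lt r e) hij'.not_gt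
      simp [standardIncidence, rootPerm_succ, Pi.single_apply, hne,
        eq_comm (a := T.standardHead r e)]
  have htri : ((T.standardIncidence r).submatrix id (T.rootPerm r)).BlockTriangular b := by
    intro i j hij
    rw [hentry i j hij.le, if_neg]
    rintro rfl
    exact lt_irrefl _ hij
  rw [htri.det]
  refine Finset.prod_eq_one fun a _ => ?_
  rw [show Matrix.toSquareBlock _ b a = 1 from ?_, Matrix.det_one]
  ext i j
  rw [Matrix.toSquareBlock_def, Matrix.of_apply, hentry _ _ (j.2.trans i.2.symm).le,
    Matrix.one_apply]
  simp [Subtype.ext_iff]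

/-- Each reversed edge negates its row, which gives `(-1)^a`; the column permutation of the standard
form gives `sgn π`. -/
theorem det_rootedIncidence (T : NamedTree m) (r : Fin (m + 1)) :
    (T.rootedIncidence r).det = T.sign r := by
  have h1 : T.rootedIncidence r = Matrix.of fun i j =>
      (Fin.cons 1 (fun e => if e ∈ T.reversed r then -1 else 1) : Fin (m + 1) → ℤ) i *
        T.standardIncidence r i j := by
    ext i j
    refine Fin.cases ?_ (fun e => ?_) i
    · simp [rootedIncidence, standardIncidence]
    · by_cases h : e ∈ T.reversed r <;>
        simp [rootedIncidence, standardIncidence, standardHead, standardTail, h]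
  have h2 := Matrix.det_permute' (T.rootPerm r) (T.standardIncidence r)
  rw [det_standardIncidence_submatrix] at h2
  have h3 : (T.standardIncidence r).det = Equiv.Perm.sign (T.rootPerm r) := by
    rcases Int.units_eq_one_or (Equiv.Perm.sign (T.rootPerm r)) with h | h <;>
      rw [h] at h2 ⊢ <;> push_cast at h2 ⊢ <;> linarith
  rw [h1, Matrix.det_mul_column, h3, Fin.prod_univ_succ, sign]
  simp

/-! ### The recursion for a single tree -/

/-- The labels of the vertices for the shifted labelling `k`. -/
def label {n : ℕ} (k : Fin n → ℤ) (v : Fin n) : ℤ := k v + ((v : ℤ) + 1)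

/-- Since `binom(x, 0) = 1`, the differences along edges vanish in column `0`, and expansion there
leaves a single minor. The right-hand side is free of `r`; at `x_v = v` it equals the sign, which is
therefore independent of the root. -/
theorem sign_mul_det_binomMatrix (T : NamedTree m) (r : Fin (m + 1)) (x : Fin (m + 1) → ℤ) :
    T.sign r * (binomMatrix x).det =
      (Matrix.of fun e j : Fin m =>
        Ring.choose (x (T.head e)) ((j : ℕ) + 1) - Ring.choose (x (T.tail e)) ((j : ℕ) + 1)).det := by
  have hrow : ∀ e : Fin m, ∀ j, (T.rootedIncidence r * binomMatrix x) e.succ j =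
      Ring.choose (x (T.head e)) (j : ℕ) - Ring.choose (x (T.tail e)) (j : ℕ) := by
    intro e j
    simp [rootedIncidence, Matrix.mul_apply, binomMatrix, sub_mul, Finset.sum_sub_distrib,
      Pi.single_apply]
  have hzero : (T.rootedIncidence r * binomMatrix x) 0 0 = 1 := by
    simp [rootedIncidence, Matrix.mul_apply, binomMatrix, Pi.single_apply]
  rw [← det_rootedIncidence, ← Matrix.det_mul, Matrix.det_succ_column_zero, Fin.sum_univ_succ]
  simp only [hzero, hrow]
  simp only [Fin.val_zero, Ring.choose_zero_right, sub_self, mul_zero, zero_mul,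
    Finset.sum_const_zero, add_zero, pow_zero, one_mul]
  congr 1
  ext e j
  simp [hrow]

theorem sign_mul_sign (T : NamedTree m) (r : Fin (m + 1)) : T.sign r * T.sign r = 1 := by
  have h : (T.sign r) ^ 2 = 1 := by
    rcases Int.units_eq_one_or (Equiv.Perm.sign (T.rootPerm r)) with h | h <;>
      simp [sign, h, ← pow_mul, mul_comm _ 2]
  rwa [sq] at h

/-- The sign of the path is `1`, whichever root is used. -/
theorem sign_basic (r : Fin (m + 1)) : (basic m).sign r = 1 := by
  -- With `x_v = v`, Pascal's rule turns the difference matrix of the path into the binomial matrix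
  -- one size smaller, and both binomial determinants are `1`.
  have h := (basic m).sign_mul_det_binomMatrix r fun v => ((v : ℕ) : ℤ)
  rw [det_binomMatrix_natCast, mul_one] at h
  rw [h, ← det_binomMatrix_natCast m]
  congr 1
  ext e j
  have := Ring.choose_succ_succ (e : ℤ) (j : ℕ)
  simp [basic, binomMatrix, this]

/-- The admissible shifted edge labellings, as a product of intervals. -/
noncomputable def admissibleFinset (T : NamedTree m) (k : Fin (m + 1) → ℤ) : Finset (Fin m → ℤ) :=
  Fintype.piFinset fun e =>
    Finset.Ico (min (label k (T.tail e)) (label k (T.head e)) - ((e : ℤ) + 1))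
      (max (label k (T.tail e)) (label k (T.head e)) - ((e : ℤ) + 1))

theorem mem_admissibleFinset {T : NamedTree m} {k : Fin (m + 1) → ℤ} {l : Fin m → ℤ} :
    l ∈ T.admissibleFinset k ↔ T.Admissible k l := by
  simp only [admissibleFinset, Fintype.mem_piFinset, Finset.mem_Ico, Admissible, label]
  refine forall_congr' fun e => ?_
  split_ifs <;> omega

theorem neg_one_pow_card_inversions (T : NamedTree m) (k : Fin (m + 1) → ℤ) :
    ((-1) ^ (T.inversions k).card : ℤ) =
      ∏ e, if label k (T.tail e) < label k (T.head e) then 1 else -1 := by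
  rw [Finset.prod_ite, Finset.prod_const_one, one_mul, Finset.prod_const]
  rfl

/-- This is the recursion that the signed enumeration satisfies when its penultimate row `l` is
fixed. -/
theorem sum_admissibleFinset (T : NamedTree m) (r : Fin (m + 1)) (k : Fin (m + 1) → ℤ) :
    ∑ l ∈ T.admissibleFinset k,
        (-1) ^ (T.inversions k).card * T.sign r * (binomMatrix (label l)).det =
      (binomMatrix (label k)).det := by
  have hsum : ∑ l ∈ T.admissibleFinset k,
      (-1) ^ (T.inversions k).card * (binomMatrix (label l)).det =
        T.sign r * (binomMatrix (label k)).det := by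
    rw [sign_mul_det_binomMatrix, neg_one_pow_card_inversions]
    -- Expanding a determinant whose rows are sums amounts to choosing one value per edge, that is,
    -- an admissible vector. The inversion signs are distributed over the rows, and the shift `e +
    -- 1` passes from edge entries to edge labels.
    have := (Matrix.detRowAlternating (R := ℤ) (n := Fin m)).toMultilinearMap.map_sum_finset
      (fun e (y : ℤ) (j : Fin m) =>
        (if label k (T.tail e) < label k (T.head e) then 1 else -1) *
          Ring.choose (y + ((e : ℤ) + 1)) (j : ℕ))
      (fun e => Finset.Ico (min (label k (T.tail e)) (label k (T.head e)) - ((e : ℤ) + 1))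
        (max (label k (T.tail e)) (label k (T.head e)) - ((e : ℤ) + 1)))
    refine Eq.trans (Finset.sum_congr rfl fun l _ => ?_) (this.symm.trans ?_)
    · exact (Matrix.det_mul_column _ _).symm
    · change Matrix.det _ = _
      congr 1
      ext e j
      rw [Finset.sum_apply]
      exact signed_sum_Ico_eq_sub (f := fun y => Ring.choose y ((j : ℕ) + 1))
        (g := fun y => Ring.choose y (j : ℕ))
        (fun y => by rw [Ring.choose_succ_succ, add_comm]) _ _ _
  calc _ = T.sign r * ∑ l ∈ T.admissibleFinset k,
      (-1) ^ (T.inversions k).card * (binomMatrix (label l)).det := by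
        rw [Finset.mul_sum]
        exact Finset.sum_congr rfl fun _ _ => by ring
    _ = _ := by rw [hsum, ← mul_assoc, sign_mul_sign, one_mul]

end NamedTree

/-! ### Paths and classical patterns -/

namespace NamedTree

variable {m : ℕ}

/-- The shifts at the two ends of an edge of the path differ by one, which over the integers
exchanges strict and weak inequalities. -/
theorem admissible_basic_iff {k : Fin (m + 1) → ℤ} {l : Fin m → ℤ} :
    (basic m).Admissible k l ↔ ∀ j : Fin m,
      if k j.castSucc ≤ k j.succ then k j.castSucc ≤ l j ∧ l j ≤ k j.succ
      else k j.castSucc > l j ∧ l j > k j.succ := by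
  refine forall_congr' fun j => ?_
  change (if k j.castSucc + (((j.castSucc : ℕ) : ℤ) + 1) < k j.succ + (((j.succ : ℕ) : ℤ) + 1) then
      k j.castSucc + (((j.castSucc : ℕ) : ℤ) + 1) ≤ l j + (((j : ℕ) : ℤ) + 1) ∧
        l j + (((j : ℕ) : ℤ) + 1) < k j.succ + (((j.succ : ℕ) : ℤ) + 1)
    else
      k j.succ + (((j.succ : ℕ) : ℤ) + 1) ≤ l j + (((j : ℕ) : ℤ) + 1) ∧
        l j + (((j : ℕ) : ℤ) + 1) < k j.castSucc + (((j.castSucc : ℕ) : ℤ) + 1)) ↔ _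
  simp only [Fin.val_castSucc, Fin.val_succ]
  split_ifs <;> push_cast at * <;> omega

theorem inversions_basic (k : Fin (m + 1) → ℤ) :
    (basic m).inversions k = Finset.univ.filter fun j : Fin m => k j.castSucc > k j.succ := by
  ext j
  simp only [inversions, Finset.mem_filter, Finset.mem_univ, true_and]
  change ¬ (k j.castSucc + (((j.castSucc : ℕ) : ℤ) + 1) < k j.succ + (((j.succ : ℕ) : ℤ) + 1)) ↔ _
  simp only [Fin.val_castSucc, Fin.val_succ]
  push_cast
  omega

end NamedTree

/-! ### Induction on the order of the tree sequence -/

namespace TreeSeq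

variable {n : ℕ}

/-- The tree sequence without its last tree. -/
def init (T : TreeSeq (n + 1)) : TreeSeq n := fun i => T i.castSucc

/-- The sequence of vectors extended by the last vector `k`. -/
def snocRow (k : Fin (n + 1) → ℤ) (L : Rows n) : Rows (n + 1) :=
  Fin.snoc (α := fun i : Fin (n + 2) => Fin (i : ℕ) → ℤ) L k

theorem snocRow_last (k : Fin (n + 1) → ℤ) (L : Rows n) : snocRow k L (Fin.last (n + 1)) = k :=
  Fin.snoc_last (α := fun i : Fin (n + 2) => Fin (i : ℕ) → ℤ) k L

theorem snocRow_castSucc (k : Fin (n + 1) → ℤ) (L : Rows n) (i : Fin (n + 1)) :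
    snocRow k L i.castSucc = L i :=
  Fin.snoc_castSucc (α := fun i : Fin (n + 2) => Fin (i : ℕ) → ℤ) k L i

theorem snocRow_injective (k : Fin (n + 1) → ℤ) : Function.Injective (snocRow k) := by
  intro L L' h
  funext i
  rw [← snocRow_castSucc k L i, h, snocRow_castSucc]

theorem snocRow_mem_gelfandTsetlin_iff {T : TreeSeq (n + 1)} {k : Fin (n + 1) → ℤ} {L : Rows n} :
    snocRow k L ∈ T.gelfandTsetlin k ↔
      (T (Fin.last n)).Admissible k (L (Fin.last n)) ∧
        L ∈ T.init.gelfandTsetlin (L (Fin.last n)) := by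
  have hlast : (T (Fin.last n)).Admissible (snocRow k L (Fin.last n).succ)
      (snocRow k L (Fin.last n).castSucc) ↔ (T (Fin.last n)).Admissible k (L (Fin.last n)) := by
    rw [snocRow_castSucc]
    exact iff_of_eq (congrArg (fun x => (T (Fin.last n)).Admissible x (L (Fin.last n)))
      (snocRow_last k L))
  have hcast : ∀ i : Fin n, (T i.castSucc).Admissible (snocRow k L i.castSucc.succ)
      (snocRow k L i.castSucc.castSucc) ↔
        (T.init i).Admissible (L i.succ) (L i.castSucc) := by
    intro i
    rw [snocRow_castSucc]
    exact iff_of_eq (congrArg (fun x => (T i.castSucc).Admissible x (L i.castSucc))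
      (snocRow_castSucc k L i.succ))
  simp only [gelfandTsetlin, Set.mem_ofPred_eq, snocRow_last, true_and]
  rw [Fin.forall_fin_succ', hlast, and_comm]
  exact and_congr_right fun _ => forall_congr' hcast

/-- Sorting by the penultimate row `l` reduces finiteness and the signed sum to order `n`. -/
theorem gelfandTsetlin_succ (T : TreeSeq (n + 1)) (k : Fin (n + 1) → ℤ) :
    T.gelfandTsetlin k =
      ⋃ l ∈ (↑((T (Fin.last n)).admissibleFinset k) : Set (Fin (Fin.last n : ℕ) → ℤ)),
        snocRow k '' T.init.gelfandTsetlin l := by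
  ext L
  simp only [Set.mem_iUnion, Set.mem_image, exists_prop]
  constructor
  · intro h
    obtain ⟨L', rfl⟩ : ∃ L', snocRow k L' = L := by
      refine ⟨fun i => L i.castSucc, ?_⟩
      funext i
      refine Fin.lastCases ?_ (fun i => ?_) i
      · rw [snocRow_last]
        exact h.1.symm
      · rw [snocRow_castSucc]
    rw [snocRow_mem_gelfandTsetlin_iff] at h
    exact ⟨_, NamedTree.mem_admissibleFinset.2 h.1, L', h.2, rfl⟩
  · rintro ⟨l, hl, L', hL', rfl⟩
    rw [snocRow_mem_gelfandTsetlin_iff, hL'.1]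
    exact ⟨NamedTree.mem_admissibleFinset.1 hl, hL'⟩

theorem signOf_snocRow (T : TreeSeq (n + 1)) (r : (i : Fin (n + 1)) → Fin ((i : ℕ) + 1))
    (k : Fin (n + 1) → ℤ) (L : Rows n) :
    T.signOf r (snocRow k L) =
      (-1) ^ ((T (Fin.last n)).inversions k).card * (T (Fin.last n)).sign (r (Fin.last n)) *
        T.init.signOf (fun i => r i.castSucc) L := by
  have hlast : ((T (Fin.last n)).inversions (snocRow k L (Fin.last n).succ)).card =
      ((T (Fin.last n)).inversions k).card :=
    congrArg (fun x => ((T (Fin.last n)).inversions x).card) (snocRow_last k L)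
  have hcast : ∀ i : Fin n, ((T i.castSucc).inversions (snocRow k L i.castSucc.succ)).card =
      ((T.init i).inversions (L i.succ)).card := fun i =>
    congrArg (fun x => ((T i.castSucc).inversions x).card) (snocRow_castSucc k L i.succ)
  simp only [signOf, sign]
  rw [Fin.sum_univ_castSucc, Fin.prod_univ_castSucc, hlast, Finset.sum_congr rfl fun i _ => hcast i,
    pow_add]
  simp only [init]
  ring

theorem finite_and_signedEnum_eq (T : TreeSeq n) (r : (i : Fin n) → Fin ((i : ℕ) + 1))
    (k : Fin n → ℤ) :
    (T.gelfandTsetlin k).Finite ∧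
      T.signedEnum r k = (binomMatrix (NamedTree.label k)).det := by
  induction n with
  | zero =>
    -- For `n = 0` the only array consists of the empty row; its sign and the empty determinant are
    -- both `1`.
    have : Unique (Rows 0) :=
      { default := fun i => Fin.cases k (fun j => j.elim0) i
        uniq := fun L => by
          funext i j
          exact (Fin.cast (by simp) j : Fin 0).elim0 }
    refine ⟨Set.toFinite _, ?_⟩
    have huniv : T.gelfandTsetlin k = Set.univ :=
      Set.eq_univ_of_forall fun L => ⟨funext fun j => j.elim0, fun i => i.elim0⟩
    rw [signedEnum, huniv, finsum_mem_univ, finsum_unique]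
    simp [signOf, sign]
  | succ n ih =>
    have hfin : ∀ l, (snocRow k '' T.init.gelfandTsetlin l).Finite := fun l =>
      (ih T.init (fun i => r i.castSucc) l).1.image _
    rw [signedEnum, gelfandTsetlin_succ]
    refine ⟨(Finset.finite_toSet _).biUnion fun l _ => hfin l, ?_⟩
    refine (finsum_mem_biUnion ?_ (Finset.finite_toSet _) fun l _ => hfin l).trans ?_
    rotate_left
    · rw [finsum_mem_coe_finset,
        ← (T (Fin.last n)).sum_admissibleFinset (r (Fin.last n)) k]
      refine Finset.sum_congr rfl fun l _ => ?_
      have hsum := (ih T.init (fun i => r i.castSucc) l).2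
      rw [finsum_mem_image (snocRow_injective k).injOn]
      simp only [signOf_snocRow]
      refine (mul_finsum_mem _ _).symm.trans ?_
      exact congrArg _ hsum
    -- The pieces are disjoint because the last row of `L` recovers `l`.
    · intro l _ l' _ hne
      refine Set.disjoint_left.2 ?_
      rintro _ ⟨L, hL, rfl⟩ ⟨L', hL', h⟩
      rw [(snocRow_injective k) h] at hL'
      exact hne (hL.1.symm.trans hL'.1)

theorem gelfandTsetlin_basic (k : Fin n → ℤ) :
    (basic n).gelfandTsetlin k = generalizedGTPatterns k := by
  ext a
  exact and_congr_right fun _ => forall_congr' fun i => NamedTree.admissible_basic_iff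

theorem signOf_basic (r : (i : Fin n) → Fin ((i : ℕ) + 1)) (a : Rows n) :
    (basic n).signOf r a = gtPatternSign a := by
  have hsign : (basic n).sign r = 1 := Finset.prod_eq_one fun i _ => NamedTree.sign_basic (r i)
  rw [signOf, hsign, mul_one, gtPatternSign]
  congr 1
  exact Finset.sum_congr rfl fun i _ =>
    congrArg Finset.card (NamedTree.inversions_basic (a i.succ))

theorem signedEnum_eq_prod (T : TreeSeq n) (r : (i : Fin n) → Fin ((i : ℕ) + 1))
    (k : Fin n → ℤ) :
    (T.signedEnum r k : ℚ) = ∏ i : Fin n, ∏ j ∈ Finset.Ioi i,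
      ((k j : ℚ) - (k i : ℚ) + (j : ℚ) - (i : ℚ)) / ((j : ℚ) - (i : ℚ)) := by
  rw [(T.finite_and_signedEnum_eq r k).2, det_binomMatrix_eq_prod_div]
  refine Finset.prod_congr rfl fun i _ => Finset.prod_congr rfl fun j _ => ?_
  simp only [NamedTree.label]
  push_cast
  ring

end TreeSeq

theorem theorem1 (n : ℕ) (k : Fin n → ℤ) :
    (∀ (T : TreeSeq n) (r : (i : Fin n) → Fin ((i : ℕ) + 1)),
      (T.gelfandTsetlin k).Finite ∧
      (T.signedEnum r k : ℚ) =
        ∏ i : Fin n, ∏ j ∈ Finset.Ioi i,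
          ((k j : ℚ) - (k i : ℚ) + (j : ℚ) - (i : ℚ)) / ((j : ℚ) - (i : ℚ))) ∧
    ((TreeSeq.basic n).gelfandTsetlin k = generalizedGTPatterns k ∧
      (∀ (r : (i : Fin n) → Fin ((i : ℕ) + 1)), ∀ a ∈ generalizedGTPatterns k,
        (TreeSeq.basic n).signOf r a = gtPatternSign a) ∧
      ((∑ᶠ a ∈ generalizedGTPatterns k, gtPatternSign a : ℤ) : ℚ) =
        ∏ i : Fin n, ∏ j ∈ Finset.Ioi i,
          ((k j : ℚ) - (k i : ℚ) + (j : ℚ) - (i : ℚ)) / ((j : ℚ) - (i : ℚ))) := by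
  refine ⟨fun T r => ⟨(T.finite_and_signedEnum_eq r k).1, T.signedEnum_eq_prod r k⟩,
    TreeSeq.gelfandTsetlin_basic k, fun r a _ => TreeSeq.signOf_basic r a, ?_⟩
  rw [← TreeSeq.signedEnum_eq_prod (TreeSeq.basic n) (fun _ => 0) k, TreeSeq.signedEnum,
    TreeSeq.gelfandTsetlin_basic]
  simp only [TreeSeq.signOf_basic]
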